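/- Let $G$ be a finite simple connected graph of order $n$ that is claw-free, i.e. has no induced subgraph isomorphic to $K_{1,3}$. Let $\Delta(G)$ be its maximum degree, and let $\chi_D(G)$ be its distinguishing chromatic number, i.e. the minimum number of colours in a proper vertex colouring of $G$ for which the identity is the only colour-preserving automorphism of $G$. Then $$\chi_D(G)\leq \Delta(G)+2.$$ Moreover, $\chi_D(G)=\Delta(G)+2$ if and only if $G\cong C_6$, or $n$ is even and $G\cong K_{n/2}[2K_1]$, the complete multipartite graph with $n/2$ parts, each of size $2$. -/

import Mathlib

namespace SimpleGraph

variable {V : Type*} {α : Type*}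

/-- A proper vertex colouring `c` of `G` is distinguishing if every vertex is a fixed point of
every automorphism of `G` that preserves `c`. -/
def Coloring.IsDistinguishing {G : SimpleGraph V} (c : G.Coloring α) : Prop :=
  ∀ φ : G ≃g G, (∀ v, c (φ v) = c v) → ∀ v, φ v = v

/-- `G` has a proper distinguishing vertex colouring with at most `k` colours. -/
def DistinguishingColorable (G : SimpleGraph V) (k : ℕ) : Prop :=
  ∃ c : G.Coloring (Fin k), c.IsDistinguishing

/-- The distinguishing chromatic number: the minimum number of colours in a proper
distinguishing vertex colouring, with value `⊤` if no finite number of colours suffices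
(which never happens for a finite graph). -/
noncomputable def distinguishingChromaticNumber (G : SimpleGraph V) : ℕ∞ :=
  ⨅ k ∈ {k : ℕ | G.DistinguishingColorable k}, (k : ℕ∞)

/-- The claw `K_{1,3}`. -/
abbrev claw : SimpleGraph (Fin 1 ⊕ Fin 3) := completeBipartiteGraph (Fin 1) (Fin 3)

/-- `G` is claw-free if the claw is not an induced subgraph of `G`. -/
def ClawFree (G : SimpleGraph V) : Prop := ¬ claw.IsIndContained G

end SimpleGraph

namespace SimpleGraph

/-! ### Claw-freeness and rigidity of coloured automorphisms -/

section

variable {V W α : Type*} {G : SimpleGraph V} {H : SimpleGraph W}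

/-! In a connected claw-free graph, a colour-preserving automorphism that fixes one closed
neighbourhood pointwise is trivial (`ClawFree.eq_of_fix_neighbors`). So it suffices to single out a
root `r` by its colours and then separate its neighbours. By `exists_coloring_extending`, a
colouring of the closed neighbourhood of `r` extends to the graph with `K + 1` colours so that
colour `0` occurs outside only at vertices of degree `K` with rainbow neighbourhood. A root coloured
`0` is therefore fixed if its degree is below `K`, or if two of its neighbours share a colour.

The first option with `K = Δ + 1` gives the upper bound. With `K = Δ`, failure of `Δ + 1` colours
forces `G` to be regular, and the second option forces any two nonadjacent neighbours of a vertex to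
be joined to all its other neighbours. If `Δ ≥ 3` and `G` is not complete, this gives `n = Δ + 2`,
so nonadjacency pairs off the vertices. If `Δ = 2`, `G` is a cycle, and only `C_4` (again such a
graph) and `C_6` resist three colours. -/

theorem ClawFree.adj_of_adj (hG : G.ClawFree) {x a b c : V} (ha : G.Adj x a) (hb : G.Adj x b)
    (hc : G.Adj x c) (hab : a ≠ b) (hac : a ≠ c) (hbc : b ≠ c) :
    G.Adj a b ∨ G.Adj a c ∨ G.Adj b c := by
  by_contra! h
  obtain ⟨h1, h2, h3⟩ := h
  refine hG ⟨⟨⟨Sum.elim (fun _ => x) ![a, b, c], ?_⟩, ?_⟩⟩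
  · rintro (i | i) (j | j) hij
    · exact congrArg _ (Subsingleton.elim _ _)
    · fin_cases j <;> simp_all
    · fin_cases i <;> simp_all
    · fin_cases i <;> fin_cases j <;> simp_all
  · intro i j
    change G.Adj (Sum.elim (fun _ => x) ![a, b, c] i) (Sum.elim (fun _ => x) ![a, b, c] j) ↔ _
    rcases i with i | i <;> rcases j with j | j
    · simp
    · fin_cases j <;> simp [ha, hb, hc]
    · fin_cases i <;> simp [ha.symm, hb.symm, hc.symm]
    · have h1' : ¬ G.Adj b a := fun h => h1 h.symm
      have h2' : ¬ G.Adj c a := fun h => h2 h.symm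
      have h3' : ¬ G.Adj c b := fun h => h3 h.symm
      fin_cases i <;> fin_cases j <;> simp [h1, h2, h3, h1', h2', h3']

theorem ClawFree.of_iso (hG : G.ClawFree) (e : G ≃g H) : H.ClawFree :=
  fun ⟨f⟩ => hG ⟨e.symm.toEmbedding.comp f⟩

theorem Connected.forall_of_adj (hG : G.Connected) {p : V → Prop} {r : V} (hr : p r)
    (h : ∀ x y, G.Adj x y → p x → p y) (v : V) : p v := by
  obtain ⟨w⟩ := hG r v
  induction w with
  | nil => exact hr
  | cons hadj _ ih => exact ih (h _ _ hadj hr)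

theorem DistinguishingColorable.of_iso {k : ℕ} (h : G.DistinguishingColorable k) (e : G ≃g H) :
    H.DistinguishingColorable k := by
  obtain ⟨c, hc⟩ := h
  refine ⟨c.comp e.symm.toHom, fun φ hφ v => ?_⟩
  have := hc ((e.trans φ).trans e.symm) (fun v => by simpa using hφ (e v)) (e.symm v)
  simpa using this

theorem DistinguishingColorable.mono {k m : ℕ} (h : G.DistinguishingColorable k) (hkm : k ≤ m) :
    G.DistinguishingColorable m := by
  obtain ⟨c, hc⟩ := h
  refine ⟨Coloring.mk (fun v => Fin.castLE hkm (c v)) fun {v w} hvw heq =>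
    c.valid hvw (Fin.castLE_injective hkm heq), fun φ hφ => hc φ fun v => ?_⟩
  exact Fin.castLE_injective hkm (hφ v)

theorem distinguishingChromaticNumber_le_iff {k : ℕ} :
    G.distinguishingChromaticNumber ≤ k ↔ G.DistinguishingColorable k := by
  constructor
  · intro h
    have h' : G.distinguishingChromaticNumber < ((k + 1 : ℕ) : ℕ∞) :=
      h.trans_lt (by exact_mod_cast k.lt_succ_self)
    simp only [distinguishingChromaticNumber, iInf_lt_iff, Set.mem_ofPred_eq, Nat.cast_lt] at h'
    obtain ⟨m, hm, hmk⟩ := h'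
    exact hm.mono (by omega)
  · intro h
    exact iInf₂_le k h

/-- In a connected claw-free graph, an automorphism preserving a proper colouring is trivial as soon
as it fixes a vertex and all its neighbours. -/
theorem ClawFree.eq_of_fix_neighbors (hG : G.ClawFree) (hconn : G.Connected) (c : G.Coloring α)
    (φ : G ≃g G) (hφ : ∀ v, c (φ v) = c v) {r : V} (hr : φ r = r)
    (hN : ∀ v, G.Adj r v → φ v = v) (v : V) : φ v = v := by
  refine (hconn.forall_of_adj (p := fun x => φ x = x ∧ ∀ y, G.Adj x y → φ y = y)
    ⟨hr, hN⟩ ?_ v).1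
  rintro x y hxy ⟨hx, hx'⟩
  refine ⟨hx' y hxy, fun z hyz => ?_⟩
  by_cases hxz : G.Adj x z
  · exact hx' z hxz
  by_contra hne
  have hy := hx' y hxy
  have hyz' : G.Adj y (φ z) := by
    have := φ.map_rel_iff.2 hyz
    rwa [hy] at this
  have hxz' : ¬ G.Adj x (φ z) := fun h => hxz (φ.map_rel_iff.1 (by rwa [hx]))
  -- The neighbours `x`, `z`, `φ z` of `y` would form a claw: `x` is adjacent to neither of the
  -- others, and `z`, `φ z` share a colour.
  rcases hG.adj_of_adj hxy.symm hyz hyz' (by rintro rfl; exact hne hx)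
    (fun h => hne (by rw [show z = x from φ.injective (by rw [hx, ← h]), hx]))
    (Ne.symm hne) with h | h | h
  · exact hxz h
  · exact hxz' h
  · exact c.valid h (hφ z).symm

end

/-! ### Extending colourings from a closed neighbourhood -/

section

variable {V : Type*} [Fintype V] {G : SimpleGraph V} [DecidableRel G.Adj]

/-- A proper colouring of a closed neighbourhood extends to the whole graph, with the colour `0`
being used outside only at vertices which see all the other colours. -/
theorem exists_coloring_extending {K : ℕ} (hK : ∀ v, G.degree v ≤ K) (r : V)
    (c₀ : V → Fin (K + 1))
    (hc₀ : ∀ v w, (v = r ∨ G.Adj r v) → (w = r ∨ G.Adj r w) → G.Adj v w → c₀ v ≠ c₀ w) :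
    ∃ c : G.Coloring (Fin (K + 1)), (∀ v, (v = r ∨ G.Adj r v) → c v = c₀ v) ∧
      ∀ v, v ≠ r → ¬ G.Adj r v → c v = 0 →
        G.degree v = K ∧ Set.InjOn c (G.neighborSet v) := by
  classical
  set S : Set V := {v | v = r ∨ G.Adj r v} with hS
  have hfree : ∀ (c : V → Fin (K + 1)) (v : V), ∃ a, ∀ w, G.Adj v w → c w ≠ a := by
    intro c v
    by_contra! h
    have : (Finset.univ : Finset (Fin (K + 1))) ⊆ (G.neighborFinset v).image c := by
      intro a _
      obtain ⟨w, hw, hwa⟩ := h a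
      exact Finset.mem_image.2 ⟨w, by simpa using hw, hwa⟩
    have := (Finset.card_le_card this).trans Finset.card_image_le
    have hKv := hK v
    simp at this
    omega
  let bad : (V → Fin (K + 1)) → Finset V := fun c => {v | ∃ w, G.Adj v w ∧ c v = c w}
  have hproper : ∃ c : V → Fin (K + 1), (∀ v ∈ S, c v = c₀ v) ∧
      ∀ v w, G.Adj v w → c v ≠ c w := by
    -- Minimise the number of vertices in conflict: giving a conflicting vertex outside `S` a free
    -- colour would lower it.
    obtain ⟨c, hc, hmin⟩ := ({c | ∀ v ∈ S, c v = c₀ v} : Finset (V → Fin (K + 1))).exists_min_image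
      (fun c => (bad c).card) ⟨c₀, by simp⟩
    simp only [Finset.mem_filter, Finset.mem_univ, true_and] at hc hmin
    have key : ∀ v w, v ∉ S → G.Adj v w → c v ≠ c w := by
      intro v w hv hvw hcvw
      obtain ⟨a, ha⟩ := hfree c v
      have hlt : (bad (Function.update c v a)).card < (bad c).card := by
        refine Finset.card_lt_card (Finset.ssubset_iff_subset_ne.2 ⟨fun x hx => ?_, fun h => ?_⟩)
        · simp only [bad, Finset.mem_filter, Finset.mem_univ, true_and] at hx ⊢
          obtain ⟨y, hxy, h⟩ := hx
          by_cases hxv : x = v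
          · subst hxv
            exact ⟨w, hvw, hcvw⟩
          · by_cases hyv : y = v
            · subst hyv
              simp only [Function.update_of_ne hxv, Function.update_self] at h
              exact absurd h (ha x hxy.symm)
            · exact ⟨y, hxy, by simpa [hxv, hyv] using h⟩
        · have hv' : v ∈ bad (Function.update c v a) := by
            rw [h]; simpa [bad] using ⟨w, hvw, hcvw⟩
          simp only [bad, Finset.mem_filter, Finset.mem_univ, true_and] at hv'
          obtain ⟨y, hvy, h⟩ := hv'
          rw [Function.update_self, Function.update_of_ne hvy.ne'] at h
          exact ha y hvy h.symm
      refine absurd (hmin (Function.update c v a) fun x hx => ?_) (not_le.2 hlt)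
      rw [Function.update_of_ne (by rintro rfl; exact hv hx), hc x hx]
    refine ⟨c, hc, fun v w hvw => ?_⟩
    by_cases hv : v ∈ S
    · by_cases hw : w ∈ S
      · rw [hc v hv, hc w hw]
        exact hc₀ v w hv hw hvw
      · exact (key w v hw hvw.symm).symm
    · exact key v w hv hvw
  -- Among proper extensions, minimise the use of `0`. A `0`-vertex outside `S` then sees all `K`
  -- other colours, and having at most `K` neighbours it sees each exactly once.
  obtain ⟨c, hc, hmin⟩ := ({c | (∀ v ∈ S, c v = c₀ v) ∧ ∀ v w, G.Adj v w → c v ≠ c w} :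
    Finset (V → Fin (K + 1))).exists_min_image (fun c => (Finset.univ.filter (c · = 0)).card)
    (by simpa [Finset.Nonempty] using hproper)
  simp only [Finset.mem_filter, Finset.mem_univ, true_and] at hc hmin
  obtain ⟨hc, hval⟩ := hc
  refine ⟨Coloring.mk c fun {v w} h => hval v w h, hc, fun v hvr hrv hv0 => ?_⟩
  have hv0' : c v = 0 := hv0
  have hvS : v ∉ S := by simp [hS, hvr, hrv]
  have hsee : ∀ a, a ≠ 0 → ∃ w, G.Adj v w ∧ c w = a := by
    intro a ha0
    by_contra! ha
    have hlt : (Finset.univ.filter (Function.update c v a · = 0)).card <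
        (Finset.univ.filter (c · = 0)).card := by
      refine Finset.card_lt_card (Finset.ssubset_iff_subset_ne.2 ⟨fun x hx => ?_, fun h => ?_⟩)
      · simp only [Finset.mem_filter, Finset.mem_univ, true_and] at hx ⊢
        by_cases hxv : x = v
        · rwa [hxv]
        · rwa [Function.update_of_ne hxv] at hx
      · have : v ∈ Finset.univ.filter (Function.update c v a · = 0) := by
          rw [h]; simpa using hv0'
        simp [ha0] at this
    refine absurd (hmin (Function.update c v a) ⟨fun x hx => ?_, fun x y hxy => ?_⟩)
      (not_le.2 hlt)
    · rw [Function.update_of_ne (by rintro rfl; exact hvS hx), hc x hx]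
    · by_cases hxv : x = v
      · subst hxv
        rw [Function.update_self, Function.update_of_ne hxy.ne']
        exact (ha y hxy).symm
      · by_cases hyv : y = v
        · subst hyv
          rw [Function.update_self, Function.update_of_ne hxv]
          exact ha x hxy.symm
        · rw [Function.update_of_ne hxv, Function.update_of_ne hyv]
          exact hval x y hxy
  have hsub : Finset.univ.erase (0 : Fin (K + 1)) ⊆ (G.neighborFinset v).image c := by
    intro a ha
    obtain ⟨w, hw, hwa⟩ := hsee a (Finset.ne_of_mem_erase ha)
    exact Finset.mem_image.2 ⟨w, by simpa using hw, hwa⟩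
  have h1 := Finset.card_le_card hsub
  have h2 : ((G.neighborFinset v).image c).card ≤ (G.neighborFinset v).card :=
    Finset.card_image_le
  have h3 := hK v
  rw [Finset.card_erase_of_mem (Finset.mem_univ _), Finset.card_univ, Fintype.card_fin] at h1
  rw [card_neighborFinset_eq_degree] at h2
  refine ⟨by omega, ?_⟩
  have h4 := Finset.card_image_iff.1
    (show ((G.neighborFinset v).image c).card = (G.neighborFinset v).card by
      rw [card_neighborFinset_eq_degree]; omega)
  rw [coe_neighborFinset] at h4
  exact h4

theorem exists_injOn_fin_ne_zero {V : Type*} {K : ℕ} (s : Finset V) (hs : s.card ≤ K) :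
    ∃ f : V → Fin (K + 1), Set.InjOn f s ∧ ∀ v ∈ s, f v ≠ 0 := by
  classical
  refine ⟨fun v => if h : v ∈ s then ((s.equivFin ⟨v, h⟩).castLE hs).succ else 0, ?_, ?_⟩
  · intro v hv w hw h
    have hv' : v ∈ s := hv
    have hw' : w ∈ s := hw
    simpa [hv', hw'] using h
  · intro v hv
    simp [hv]

/-- Colour `r` with `0` and its neighbours with distinct nonzero colours. Any other `0`-vertex has
degree `K`, so `r` is fixed, and then so is each neighbour. -/
theorem ClawFree.distinguishingColorable_of_degree_lt (hG : G.ClawFree) (hconn : G.Connected)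
    {K : ℕ} (hK : ∀ v, G.degree v ≤ K) {r : V} (hr : G.degree r < K) :
    G.DistinguishingColorable (K + 1) := by
  classical
  obtain ⟨f, hf, hf0⟩ := exists_injOn_fin_ne_zero (G.neighborFinset r) hr.le
  simp only [mem_neighborFinset] at hf0
  rw [coe_neighborFinset] at hf
  obtain ⟨c, hc, h0⟩ := exists_coloring_extending hK r (fun v => if v = r then 0 else f v) (by
    rintro v w (rfl | hv) (rfl | hw) hvw
    · exact absurd hvw (G.irrefl)
    · simpa [hvw.ne'] using (hf0 w hw).symm
    · simpa [hvw.ne] using hf0 v hv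
    · simpa [hv.ne', hw.ne'] using fun h => hvw.ne (hf hv hw h))
  have hcN : ∀ v, G.Adj r v → c v = f v := fun v hv => by rw [hc v (Or.inr hv), if_neg hv.ne']
  have hcr : c r = 0 := by rw [hc r (Or.inl rfl), if_pos rfl]
  refine ⟨c, fun φ hφ => ?_⟩
  have hr' : φ r = r := by
    by_contra hne
    have hφ0 : c (φ r) = 0 := by rw [hφ, hcr]
    have hnadj : ¬ G.Adj r (φ r) := fun h => hf0 _ h (by rw [← hcN _ h, hφ0])
    have := (h0 _ hne hnadj hφ0).1
    rw [φ.degree_eq] at this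
    omega
  refine hG.eq_of_fix_neighbors hconn c φ hφ hr' fun v hv => ?_
  have hv' : G.Adj r (φ v) := by
    have := φ.map_rel_iff.2 hv
    rwa [hr'] at this
  exact hf hv' hv (by rw [← hcN _ hv', ← hcN _ hv, hφ])

/-- Let `u` and `w` share a colour, the only repetition around `r`. Other `0`-vertices have rainbow
neighbourhoods, so `r` is fixed. The vertex `x` is then fixed by its colour, and being adjacent to
`u` but not to `w` it prevents their exchange. -/
theorem ClawFree.distinguishingColorable_of_adj_of_not_adj (hG : G.ClawFree)
    (hconn : G.Connected) {K : ℕ} (hK : ∀ v, G.degree v ≤ K) {r u w x : V} (hu : G.Adj r u)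
    (hw : G.Adj r w) (huw : ¬ G.Adj u w) (hne : u ≠ w) (hx : G.Adj r x) (hxu : G.Adj x u)
    (hxw : ¬ G.Adj x w) (hxw' : x ≠ w) :
    G.DistinguishingColorable (K + 1) := by
  classical
  obtain ⟨f, hf, hf0⟩ := exists_injOn_fin_ne_zero ((G.neighborFinset r).erase w)
    ((Finset.card_le_card (Finset.erase_subset _ _)).trans
      ((card_neighborFinset_eq_degree G r).trans_le (hK r)))
  have hf' : ∀ v v', G.Adj r v → v ≠ w → G.Adj r v' → v' ≠ w → f v = f v' → v = v' :=
    fun v v' h1 h2 h3 h4 h => hf (by simp [h1, h2]) (by simp [h3, h4]) h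
  have hf0' : ∀ v, G.Adj r v → v ≠ w → f v ≠ 0 := fun v h1 h2 => hf0 v (by simp [h1, h2])
  have key : ∀ v v', G.Adj r v → G.Adj r v' →
      f (if v = w then u else v) = f (if v' = w then u else v') →
      v = v' ∨ (v = u ∧ v' = w) ∨ (v = w ∧ v' = u) := by
    intro v v' hv hv' h
    split_ifs at h with h1 h2 h2
    · exact Or.inl (h1.trans h2.symm)
    · exact Or.inr (Or.inr ⟨h1, (hf' _ _ hu hne hv' h2 h).symm⟩)
    · exact Or.inr (Or.inl ⟨hf' _ _ hv h1 hu hne h, h2⟩)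
    · exact Or.inl (hf' _ _ hv h1 hv' h2 h)
  have key0 : ∀ v, G.Adj r v → f (if v = w then u else v) ≠ 0 := by
    intro v hv
    split_ifs with h1
    · exact hf0' u hu hne
    · exact hf0' v hv h1
  obtain ⟨c, hc, h0⟩ := exists_coloring_extending hK r
    (fun v => if v = r then 0 else f (if v = w then u else v)) (by
    rintro v v' (rfl | hv) (rfl | hv') hvv'
    · exact absurd hvv' (G.irrefl)
    · simpa only [if_true, if_neg hvv'.ne'] using (key0 v' hv').symm
    · simpa only [if_true, if_neg hvv'.ne] using key0 v hv
    · simp only [if_neg hv.ne', if_neg hv'.ne']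
      intro h
      rcases key v v' hv hv' h with rfl | ⟨rfl, rfl⟩ | ⟨rfl, rfl⟩
      · exact G.irrefl hvv'
      · exact huw hvv'
      · exact huw hvv'.symm)
  have hcN : ∀ v, G.Adj r v → c v = f (if v = w then u else v) := fun v hv => by
    rw [hc v (Or.inr hv), if_neg hv.ne']
  have hcr : c r = 0 := by rw [hc r (Or.inl rfl), if_pos rfl]
  refine ⟨c, fun φ hφ => ?_⟩
  have hr' : φ r = r := by
    by_contra hne'
    have hφ0 : c (φ r) = 0 := by rw [hφ, hcr]
    have hnadj : ¬ G.Adj r (φ r) := fun h => key0 _ h (by rw [← hcN _ h, hφ0])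
    refine hne (φ.injective ((h0 _ hne' hnadj hφ0).2 (φ.map_rel_iff.2 hu) (φ.map_rel_iff.2 hw) ?_))
    rw [hφ, hφ, hcN _ hu, hcN _ hw, if_pos rfl, if_neg hne]
  have hN : ∀ v, G.Adj r v → φ v = v ∨ (φ v = u ∧ v = w) ∨ (φ v = w ∧ v = u) := by
    intro v hv
    have hv' : G.Adj r (φ v) := by
      have := φ.map_rel_iff.2 hv
      rwa [hr'] at this
    exact key _ _ hv' hv (by rw [← hcN _ hv', ← hcN _ hv, hφ])
  have hx' : φ x = x := by
    rcases hN x hx with h | ⟨-, h⟩ | ⟨-, h⟩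
    · exact h
    · exact absurd h hxw'
    · exact absurd h hxu.ne
  have hswap : φ u ≠ w := fun h => hxw (by
    have := φ.map_rel_iff.2 hxu
    rwa [hx', h] at this)
  have hu' : φ u = u := by
    rcases hN u hu with h | ⟨-, h⟩ | ⟨h, -⟩
    · exact h
    · exact absurd h hne
    · exact absurd h hswap
  refine hG.eq_of_fix_neighbors hconn c φ hφ hr' fun v hv => ?_
  rcases hN v hv with h | ⟨h, h'⟩ | ⟨h, rfl⟩
  · exact h
  · exact absurd (φ.injective (h.trans hu'.symm)) (by rw [h']; exact hne.symm)
  · exact absurd h hswap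

end

/-! ### Regular graphs of order `d + 2` and the local adjacency condition -/

section

variable {V : Type*} [Fintype V] {G : SimpleGraph V} [DecidableRel G.Adj]

/-- Two vertices of equal colour lie in the same part, and swapping such twins is an automorphism.
-/
theorem not_distinguishingColorable_completeEquipartiteGraph {m k : ℕ} (hk : k < m * 2) :
    ¬ (completeEquipartiteGraph m 2).DistinguishingColorable k := by
  rintro ⟨c, hc⟩
  obtain ⟨u, v, huv, hcuv⟩ := Fintype.exists_ne_map_eq_of_card_lt c (by simpa using hk)
  have h1 : u.1 = v.1 := by
    by_contra h
    exact c.valid (completeEquipartiteGraph_adj.2 h) hcuv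
  have hfst : ∀ x, (Equiv.swap u v x).1 = x.1 := by
    intro x
    rw [Equiv.swap_apply_def]
    split_ifs <;> simp_all
  refine huv ?_
  have := hc ⟨Equiv.swap u v, by simp [hfst]⟩ (fun x => ?_) u
  · simpa using this.symm
  · change c (Equiv.swap u v x) = c x
    rw [Equiv.swap_apply_def]
    split_ifs <;> simp_all

theorem IsRegularOfDegree.isCompleteMultipartite {d : ℕ} (hd : G.IsRegularOfDegree d)
    (hcard : Fintype.card V = d + 2) : G.IsCompleteMultipartite := by
  classical
  refine ⟨fun a b c hab hbc hac => ?_⟩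
  have hab' : a ≠ b := by rintro rfl; exact hbc hac
  have hbc' : b ≠ c := by rintro rfl; exact hab hac
  have h1 : Disjoint (G.neighborFinset b) {a, b, c} := by
    simp [G.adj_comm b a, hab, hbc]
  have h2 := Finset.card_le_univ (G.neighborFinset b ∪ {a, b, c})
  rw [Finset.card_union_of_disjoint h1, card_neighborFinset_eq_degree, hd b, hcard,
    Finset.card_eq_three.2 ⟨a, b, c, hab', hac.ne, hbc', rfl⟩] at h2
  omega

theorem IsRegularOfDegree.nonempty_iso_completeEquipartiteGraph {d : ℕ}
    (hd : G.IsRegularOfDegree d) (hcard : Fintype.card V = d + 2) :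
    Even (Fintype.card V) ∧
      Nonempty (G ≃g completeEquipartiteGraph (Fintype.card V / 2) 2) := by
  classical
  have h := hd.isCompleteMultipartite hcard
  let Q := Quotient h.setoid
  have hcl : ∀ q : Q, Nonempty ({x // h.setoid.r q.out x} ≃ Fin 2) := by
    intro q
    refine ⟨Fintype.equivFinOfCardEq ?_⟩
    -- A nonadjacency class is the complement of a neighbourhood, hence has `(d + 2) - d = 2`
    -- elements.
    have h1 : Fintype.card {x // h.setoid.r q.out x} = (G.neighborFinset q.out)ᶜ.card := by
      rw [Fintype.card_subtype]
      congr 1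
      ext x
      simp only [Finset.mem_filter, Finset.mem_univ, true_and, Finset.mem_compl,
        mem_neighborFinset]
      exact Iff.rfl
    rw [h1, Finset.card_compl, card_neighborFinset_eq_degree, hd, hcard]
    omega
  have e := fun q => (hcl q).some
  have hVQ : Fintype.card V = Fintype.card Q * 2 := by
    rw [Fintype.card_congr (h.iso.toEquiv.trans ((Equiv.sigmaCongrRight e).trans
      (Equiv.sigmaEquivProd Q (Fin 2))))]
    simp
  have hQ : Fintype.card Q = Fintype.card V / 2 := by omega
  let eQ : Q ≃ Fin (Fintype.card V / 2) := Fintype.equivFinOfCardEq hQ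
  refine ⟨⟨Fintype.card Q, by omega⟩, ⟨h.iso.trans ⟨(Equiv.sigmaCongrRight e).trans
      ((Equiv.sigmaEquivProd Q (Fin 2)).trans (eQ.prodCongr (Equiv.refl _))), ?_⟩⟩⟩
  intro a b
  simp

theorem Connected.exists_adj_adj_not_adj_of_not_top {V : Type*} {G : SimpleGraph V}
    (hG : G.Connected)
    (h : ∃ a b, a ≠ b ∧ ¬ G.Adj a b) :
    ∃ r u w, G.Adj r u ∧ G.Adj r w ∧ u ≠ w ∧ ¬ G.Adj u w := by
  by_contra! hno
  obtain ⟨a, b, hab, hnab⟩ := h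
  have hstep : ∀ x y, G.Adj x y → x = a ∨ G.Adj a x → y = a ∨ G.Adj a y := by
    rintro x y hxy (rfl | hx)
    · exact Or.inr hxy
    · by_cases hya : y = a
      · exact Or.inl hya
      · exact Or.inr (hno x a y hx.symm hxy (Ne.symm hya))
  rcases hG.forall_of_adj (p := fun v => v = a ∨ G.Adj a v) (Or.inl rfl) hstep b
    with h | h
  · exact hab h.symm
  · exact hnab h

/-- Counting shows that `u` has exactly one neighbour `r'` outside the closed neighbourhood of `r`,
and `r'` has the same neighbours as `r`. The set formed by `r`, `r'` and the neighbours of `r` is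
closed under adjacency, hence everything. The bound `3 ≤ d` supplies a third neighbour `x` of `r`.
-/
theorem IsRegularOfDegree.card_eq_of_forall_adj {d : ℕ} (hd : G.IsRegularOfDegree d)
    (hconn : G.Connected)
    (hP : ∀ r u w x, G.Adj r u → G.Adj r w → u ≠ w → ¬ G.Adj u w → G.Adj r x → x ≠ u → x ≠ w →
      G.Adj x u ∧ G.Adj x w)
    (h3 : 3 ≤ d) {r u w : V} (hu : G.Adj r u) (hw : G.Adj r w) (huw : u ≠ w)
    (hnuw : ¬ G.Adj u w) : Fintype.card V = d + 2 := by
  classical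
  obtain ⟨x, hx, hxu, hxw⟩ : ∃ x, G.Adj r x ∧ x ≠ u ∧ x ≠ w := by
    have h1 : ({u, w} : Finset V).card < (G.neighborFinset r).card := by
      rw [card_neighborFinset_eq_degree, hd r]
      exact Finset.card_le_two.trans_lt h3
    obtain ⟨x, hx, hx'⟩ := Finset.exists_mem_notMem_of_card_lt_card h1
    exact ⟨x, by simpa using hx, by simpa [not_or] using hx'⟩
  -- a further neighbour of `u` has the same neighbours as `r`
  have key : ∀ u w, G.Adj r u → G.Adj r w → u ≠ w → ¬ G.Adj u w → x ≠ u → x ≠ w →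
      ∀ z, G.Adj u z → z ≠ r → ¬ G.Adj r z → ∀ y, G.Adj r y → G.Adj z y := by
    intro u w hu hw huw hnuw hxu hxw z huz hzr hrz
    have h1 : ∀ y, G.Adj r y → y ≠ u → y ≠ w → G.Adj z y := by
      intro y hy hyu hyw
      have hyu' := (hP r u w y hu hw huw hnuw hy hyu hyw).1
      exact (hP u r z y hu.symm huz hzr.symm hrz hyu'.symm hy.ne'
        (by rintro rfl; exact hrz hy)).2.symm
    intro y hy
    by_cases hyu : y = u
    · exact hyu ▸ huz.symm
    by_cases hyw : y = w
    · subst hyw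
      have hx' := hP r u y x hu hw huw hnuw hx hxu hxw
      -- The remaining vertex, called `w` above, is reached through `x`: it and `u` are nonadjacent
      -- neighbours of `x`, and `z` is a third one.
      exact (hP x u y z hx'.1 hx'.2 huw hnuw (h1 x hx hxu hxw).symm huz.ne'
        (by rintro rfl; exact hrz hw)).2
    · exact h1 y hy hyu hyw
  have keyu := key u w hu hw huw hnuw hxu hxw
  have keyw := key w u hw hu huw.symm (fun h => hnuw h.symm) hxw hxu
  obtain ⟨r', hur', hr'r, hrr'⟩ : ∃ z, G.Adj u z ∧ z ≠ r ∧ ¬ G.Adj r z := by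
    have h1 : (insert r ((G.neighborFinset r).erase u |>.erase w)).card
        < (G.neighborFinset u).card := by
      refine (Finset.card_insert_le _ _).trans_lt ?_
      rw [Finset.card_erase_of_mem (by simp [hw, huw.symm]), Finset.card_erase_of_mem (by simp [hu]),
        card_neighborFinset_eq_degree, card_neighborFinset_eq_degree, hd, hd]
      omega
    obtain ⟨z, hz, hz'⟩ := Finset.exists_mem_notMem_of_card_lt_card h1
    simp only [mem_neighborFinset] at hz
    simp only [Finset.mem_insert, Finset.mem_erase, mem_neighborFinset, not_or, not_and] at hz'
    refine ⟨z, hz, hz'.1, hz'.2 ?_ hz.ne'⟩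
    rintro rfl
    exact hnuw hz
  have hr' := keyu r' hur' hr'r hrr'
  have hNu : ∀ z, G.Adj u z → z = r ∨ z = r' ∨ G.Adj r z := by
    have hsub : insert r (insert r' ((G.neighborFinset r).erase u |>.erase w)) ⊆
        G.neighborFinset u := by
      intro y
      simp only [Finset.mem_insert, Finset.mem_erase, mem_neighborFinset]
      rintro (rfl | rfl | ⟨hyw, hyu, hy⟩)
      · exact hu.symm
      · exact hur'
      · exact (hP r u w y hu hw huw hnuw hy hyu hyw).1.symm
    have heq := Finset.eq_of_subset_of_card_le hsub (by
      rw [Finset.card_insert_of_notMem, Finset.card_insert_of_notMem,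
        Finset.card_erase_of_mem (by simp [hw, huw.symm]), Finset.card_erase_of_mem (by simp [hu]),
        card_neighborFinset_eq_degree, card_neighborFinset_eq_degree, hd, hd]
      · omega
      · simp [hrr']
      · simp [hr'r.symm])
    intro z hz
    have : z ∈ G.neighborFinset u := by simpa using hz
    rw [← heq] at this
    simp only [Finset.mem_insert, Finset.mem_erase, mem_neighborFinset] at this
    tauto
  have hNw : ∀ z, G.Adj w z → z = r ∨ z = r' ∨ G.Adj r z := by
    intro z hz
    by_contra! hcon
    have := hNu z (keyw z hz hcon.1 hcon.2.2 u hu).symm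
    tauto
  have hN : ∀ v, v = r ∨ v = r' ∨ G.Adj r v := by
    refine hconn.forall_of_adj (r := r) (Or.inl rfl) ?_
    rintro y z hyz (rfl | rfl | hy)
    · exact Or.inr (Or.inr hyz)
    · have : G.neighborFinset r ⊆ G.neighborFinset y := fun v hv => by
        simp only [mem_neighborFinset] at hv ⊢
        exact hr' v hv
      have heq := Finset.eq_of_subset_of_card_le this (by simp [hd _])
      have hz : z ∈ G.neighborFinset y := by simpa using hyz
      rw [← heq] at hz
      exact Or.inr (Or.inr (by simpa using hz))
    · by_cases hyu : y = u
      · exact hNu z (hyu ▸ hyz)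
      by_cases hyw : y = w
      · exact hNw z (hyw ▸ hyz)
      by_cases hzu : z = u
      · exact Or.inr (Or.inr (hzu ▸ hu))
      by_cases hzw : z = w
      · exact Or.inr (Or.inr (hzw ▸ hw))
      have hy' := hP r u w y hu hw huw hnuw hy hyu hyw
      exact hNu z (hP y u w z hy'.1 hy'.2 huw hnuw hyz hzu hzw).1.symm
  have huniv : (Finset.univ : Finset V) = insert r (insert r' (G.neighborFinset r)) := by
    ext v
    simpa using hN v
  rw [← Finset.card_univ, huniv, Finset.card_insert_of_notMem, Finset.card_insert_of_notMem,
    card_neighborFinset_eq_degree, hd]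
  · simp [hrr']
  · simp [hr'r.symm]

/-! ### Cycles -/

theorem degree_cycleGraph {n : ℕ} (hn : 3 ≤ n) (v : Fin n) : (cycleGraph n).degree v = 2 := by
  obtain ⟨k, rfl⟩ := Nat.exists_eq_add_of_le' hn
  exact cycleGraph_degree_three_le

theorem IsRegularOfDegree.nonempty_iso_cycleGraph (hd : G.IsRegularOfDegree 2)
    (hconn : G.Connected) :
    3 ≤ Fintype.card V ∧ Nonempty (cycleGraph (Fintype.card V) ≃g G) := by
  classical
  have hcyc : G.IsCycles := fun v _ => by
    rw [← coe_neighborFinset, Set.ncard_coe_finset, card_neighborFinset_eq_degree, hd]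
  obtain ⟨v⟩ := hconn.nonempty
  obtain ⟨w, hw⟩ : (G.neighborFinset v).Nonempty := by
    rw [← Finset.card_pos, card_neighborFinset_eq_degree, hd]; norm_num
  obtain ⟨p, hp, hverts⟩ := hcyc.exists_cycle_toSubgraph_verts_eq_connectedComponentSupp
    (c := G.connectedComponentMk v) (v := v) rfl ⟨w, by simpa using hw⟩
  have hall : ∀ x, x ∈ p.support := by
    intro x
    rw [← p.mem_verts_toSubgraph, hverts]
    exact ConnectedComponent.sound (hconn x v)
  have hlen : p.length = Fintype.card V := by
    have htail : p.support.tail.toFinset = Finset.univ := by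
      ext x
      simp only [List.mem_toFinset, Finset.mem_univ, iff_true]
      rcases p.mem_support_iff.1 (hall x) with rfl | h
      · exact Walk.end_mem_tail_support hp.not_nil
      · exact h
    rw [← Finset.card_univ, ← htail, List.toFinset_card_of_nodup hp.support_nodup]
    simp
  have h3 : 3 ≤ Fintype.card V := hlen ▸ hp.three_le_length
  obtain ⟨f⟩ := (cycleGraph_isContained_iff h3).2 ⟨v, p, hp, hlen⟩
  have hbij : Function.Bijective f :=
    (Fintype.bijective_iff_injective_and_card _).2 ⟨f.injective, by simp⟩
  refine ⟨h3, ⟨⟨Equiv.ofBijective f hbij, fun {a b} => ?_⟩⟩⟩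
  refine ⟨fun h => ?_, fun h => f.toHom.map_adj h⟩
  -- Both degrees are `2`, so `f` maps neighbourhoods onto neighbourhoods and thus reflects
  -- adjacency.
  have hsub : ((cycleGraph (Fintype.card V)).neighborFinset a).image f ⊆ G.neighborFinset (f a) := by
    intro y hy
    obtain ⟨z, hz, rfl⟩ := Finset.mem_image.1 hy
    simp only [mem_neighborFinset] at hz ⊢
    exact f.toHom.map_adj hz
  have hdeg : (cycleGraph (Fintype.card V)).degree a = 2 := by
    exact degree_cycleGraph h3 a
  have heq := Finset.eq_of_subset_of_card_le hsub (by
    rw [Finset.card_image_of_injective _ hbij.1, card_neighborFinset_eq_degree,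
      card_neighborFinset_eq_degree, hd, hdeg])
  have hb : f b ∈ G.neighborFinset (f a) := by simpa using h
  rw [← heq] at hb
  obtain ⟨z, hz, hzb⟩ := Finset.mem_image.1 hb
  rw [← f.injective hzb]
  simpa using hz

end

theorem cycleGraph_adj_iff_val {n : ℕ} {u v : Fin n} (hn : 3 ≤ n) :
    (cycleGraph n).Adj u v ↔ u.val + 1 = v.val ∨ v.val + 1 = u.val ∨
      (u.val = 0 ∧ v.val + 1 = n) ∨ (v.val = 0 ∧ u.val + 1 = n) := by
  rw [cycleGraph_adj', Fin.val_sub, Fin.val_sub]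
  have hu := u.isLt
  have hv := v.isLt
  have h1 : (n - v.val + u.val) % n = if v.val ≤ u.val then u.val - v.val else n - v.val + u.val := by
    split_ifs with h
    · rw [show n - v.val + u.val = u.val - v.val + n by omega, Nat.add_mod_right,
        Nat.mod_eq_of_lt (by omega)]
    · exact Nat.mod_eq_of_lt (by omega)
  have h2 : (n - u.val + v.val) % n = if u.val ≤ v.val then v.val - u.val else n - u.val + v.val := by
    split_ifs with h
    · rw [show n - u.val + v.val = v.val - u.val + n by omega, Nat.add_mod_right,
        Nat.mod_eq_of_lt (by omega)]
    · exact Nat.mod_eq_of_lt (by omega)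
  rw [h1, h2]
  split_ifs <;> omega

/-- Colour `0` occurs only at vertex `0`, whose neighbours `1` and `n - 1` have opposite parities
and so different colours. -/
theorem distinguishingColorable_cycleGraph_of_odd {n : ℕ} (hn : 3 ≤ n) (hodd : Odd n)
    (hG : (cycleGraph n).ClawFree) (hconn : (cycleGraph n).Connected) :
    (cycleGraph n).DistinguishingColorable 3 := by
  obtain ⟨k, hk⟩ := hodd
  let col : Fin n → Fin 3 := fun i => if i.val = 0 then 0 else if i.val % 2 = 1 then 1 else 2
  have hcol : ∀ i j, col i = col j ↔ (i.val = 0 ∧ j.val = 0) ∨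
      (i.val ≠ 0 ∧ j.val ≠ 0 ∧ i.val % 2 = j.val % 2) := by
    intro i j
    simp only [col]
    split_ifs <;> simp <;> omega
  have hadj := fun u v : Fin n => cycleGraph_adj_iff_val (u := u) (v := v) hn
  refine ⟨Coloring.mk col fun {v w} h heq => ?_, fun φ hφ => ?_⟩
  · rw [hadj] at h
    rw [hcol] at heq
    omega
  have hφ' : ∀ v, col (φ v) = col v := hφ
  have h0 : φ ⟨0, by omega⟩ = ⟨0, by omega⟩ := by
    have := (hcol _ _).1 (hφ' ⟨0, by omega⟩)
    ext
    simp only at this ⊢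
    omega
  refine hG.eq_of_fix_neighbors hconn _ φ hφ h0 fun v hv => ?_
  have hv' := φ.map_rel_iff.2 hv
  rw [h0, hadj] at hv'
  rw [hadj] at hv
  have h1 := (hcol _ _).1 (hφ' v)
  ext
  simp only at hv hv'
  omega

/-- The colours are `0,1,2,0,1,2,1,2,…,1,2`. If `0` went to `3`, the path `0,1,2` would go to
`3,4,5`, and the image of `3` would be a `0`-coloured neighbour of `5`; there is none, since `n ≥ 8`
makes `6` the successor of `5` with colour `1`. -/
theorem distinguishingColorable_cycleGraph_of_even {n : ℕ} (hn : 8 ≤ n) (heven : Even n)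
    (hG : (cycleGraph n).ClawFree) (hconn : (cycleGraph n).Connected) :
    (cycleGraph n).DistinguishingColorable 3 := by
  obtain ⟨k, hk⟩ := heven
  let col : Fin n → Fin 3 := fun i =>
    if i.val = 0 ∨ i.val = 3 then 0 else if i.val = 1 ∨ (i.val ≠ 2 ∧ i.val % 2 = 0) then 1 else 2
  have hcol : ∀ i j, col i = col j ↔ ((i.val = 0 ∨ i.val = 3) ∧ (j.val = 0 ∨ j.val = 3)) ∨
      (¬ (i.val = 0 ∨ i.val = 3) ∧ ¬ (j.val = 0 ∨ j.val = 3) ∧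
        ((i.val = 1 ∨ (i.val ≠ 2 ∧ i.val % 2 = 0)) ↔ (j.val = 1 ∨ (j.val ≠ 2 ∧ j.val % 2 = 0)))) := by
    intro i j
    simp only [col]
    split_ifs <;> simp <;> omega
  have hadj := fun u v : Fin n => cycleGraph_adj_iff_val (u := u) (v := v) (by omega)
  refine ⟨Coloring.mk col fun {v w} h heq => ?_, fun φ hφ => ?_⟩
  · rw [hadj] at h
    rw [hcol] at heq
    omega
  have hφ' : ∀ v, col (φ v) = col v := hφ
  have h0 : φ ⟨0, by omega⟩ = ⟨0, by omega⟩ := by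
    have e0 := (hcol _ _).1 (hφ' ⟨0, by omega⟩)
    have e1 := (hcol _ _).1 (hφ' ⟨1, by omega⟩)
    have e2 := (hcol _ _).1 (hφ' ⟨2, by omega⟩)
    have e3 := (hcol _ _).1 (hφ' ⟨3, by omega⟩)
    have a1 := (hadj _ _).1 (φ.map_rel_iff.2 ((hadj ⟨0, by omega⟩ ⟨1, by omega⟩).2 (by simp)))
    have a2 := (hadj _ _).1 (φ.map_rel_iff.2 ((hadj ⟨1, by omega⟩ ⟨2, by omega⟩).2 (by simp)))
    have a3 := (hadj _ _).1 (φ.map_rel_iff.2 ((hadj ⟨2, by omega⟩ ⟨3, by omega⟩).2 (by simp)))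
    ext
    simp only [Nat.reduceEqDiff, Nat.reduceMod, OfNat.ofNat_ne_zero, OfNat.zero_ne_ofNat,
      one_ne_zero, zero_ne_one, or_true, or_false, not_true, not_false_iff, and_true,
      true_and, and_false, false_and, ne_eq, iff_true, iff_false, OfNat.one_ne_ofNat,
      OfNat.ofNat_ne_one, false_or] at e0 e1 e2 e3 ⊢
    generalize (φ ⟨0, by omega⟩).val = b0 at *
    generalize (φ ⟨1, by omega⟩).val = b1 at *
    generalize (φ ⟨2, by omega⟩).val = b2 at *
    generalize (φ ⟨3, by omega⟩).val = b3 at *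
    rcases e0 with e0 | e0
    · exact e0
    have h1 : b1 = 4 := by omega
    have h2 : b2 = 5 := by omega
    omega
  refine hG.eq_of_fix_neighbors hconn _ φ hφ h0 fun v hv => ?_
  have hv' := φ.map_rel_iff.2 hv
  rw [h0, hadj] at hv'
  rw [hadj] at hv
  have h1 := (hcol _ _).1 (hφ' v)
  ext
  simp only at hv hv'
  omega

set_option synthInstance.maxSize 2000 in
-- The first three alternatives say that the colouring is invariant under a reflection through two
-- opposite vertices, the last under the half-turn.
theorem exists_symmetry_of_proper_coloring_six : ∀ a b c d e f : Fin 3, a ≠ b → b ≠ c → c ≠ d →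
    d ≠ e → e ≠ f → f ≠ a →
    (a = c ∧ d = f) ∨ (a = e ∧ b = d) ∨ (b = f ∧ c = e) ∨ (a = d ∧ b = e ∧ c = f) := by
  decide

theorem not_distinguishingColorable_cycleGraph_six :
    ¬ (cycleGraph 6).DistinguishingColorable 3 := by
  rintro ⟨col, hcol⟩
  have hv : ∀ i : Fin 6, col i ≠ col (i + 1) := fun i => col.valid (by simp [cycleGraph_adj])
  have hrefl : ∀ k i : Fin 6, k - i ≠ i → ¬ ∀ j, col (k - j) = col j := fun k i hi h =>
    hi (hcol ⟨Equiv.subLeft k, by simp [cycleGraph_adj, or_comm]⟩ h i)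
  have hrot : ∀ k i : Fin 6, k + i ≠ i → ¬ ∀ j, col (k + j) = col j := fun k i hi h =>
    hi (hcol ⟨Equiv.addLeft k, by simp [cycleGraph_adj]⟩ h i)
  rcases exists_symmetry_of_proper_coloring_six (col 0) (col 1) (col 2) (col 3) (col 4) (col 5)
    (hv 0) (hv 1) (hv 2) (hv 3) (hv 4) (hv 5) with h | h | h | h
  · refine hrefl 2 0 (by decide) fun j => ?_
    fin_cases j <;> simp_all
  · refine hrefl 4 0 (by decide) fun j => ?_
    fin_cases j <;> simp_all
  · refine hrefl 0 1 (by decide) fun j => ?_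
    fin_cases j
    exacts [rfl, h.1.symm, h.2.symm, rfl, h.2, h.1]
  · refine hrot 3 0 (by decide) fun j => ?_
    fin_cases j <;> simp_all

/-! ### Identifying the extremal graphs -/

variable {V : Type*} [Fintype V] {G : SimpleGraph V} [DecidableRel G.Adj]

theorem distinguishingColorable_card {V : Type*} [Fintype V] {G : SimpleGraph V} :
    G.DistinguishingColorable (Fintype.card V) := by
  classical
  let e := Fintype.equivFin V
  exact ⟨Coloring.mk e fun {_ _} h heq => h.ne (e.injective heq), fun φ hφ v => e.injective (hφ v)⟩

theorem IsRegularOfDegree.exists_iso_cycleGraph_of_not_distinguishingColorable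
    (hd : G.IsRegularOfDegree 2) (hconn : G.Connected) (hG : G.ClawFree)
    (h : ¬ G.DistinguishingColorable 3) :
    Nonempty (G ≃g cycleGraph 6) ∨ Fintype.card V = 4 := by
  obtain ⟨h3, ⟨e⟩⟩ := hd.nonempty_iso_cycleGraph hconn
  have hG' := hG.of_iso e.symm
  have hconn' := e.connected_iff.2 hconn
  rcases Nat.even_or_odd (Fintype.card V) with heven | hodd
  · have h8 : Fintype.card V < 8 := by
      by_contra! h8
      exact h ((distinguishingColorable_cycleGraph_of_even h8 heven hG' hconn').of_iso e)
    obtain ⟨k, hk⟩ := heven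
    have h46 : Fintype.card V = 4 ∨ Fintype.card V = 6 := by omega
    refine h46.symm.imp_left fun h6 => ?_
    rw [h6] at e
    exact ⟨e.symm⟩
  · exact absurd ((distinguishingColorable_cycleGraph_of_odd h3 hodd hG' hconn').of_iso e) h

theorem ClawFree.exceptional_of_not_distinguishingColorable (hG : G.ClawFree)
    (hconn : G.Connected) (h : ¬ G.DistinguishingColorable (G.maxDegree + 1)) :
    Nonempty (G ≃g cycleGraph 6) ∨ (Even (Fintype.card V) ∧
      Nonempty (G ≃g completeEquipartiteGraph (Fintype.card V / 2) 2)) := by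
  classical
  have hreg : G.IsRegularOfDegree G.maxDegree := by
    intro r
    refine (G.degree_le_maxDegree r).antisymm (not_lt.1 fun hr => h ?_)
    exact hG.distinguishingColorable_of_degree_lt hconn G.degree_le_maxDegree hr
  have hP : ∀ r u w x, G.Adj r u → G.Adj r w → u ≠ w → ¬ G.Adj u w → G.Adj r x → x ≠ u →
      x ≠ w → G.Adj x u ∧ G.Adj x w := by
    intro r u w x hu hw huw hnuw hx hxu hxw
    rcases hG.adj_of_adj hu hw hx huw hxu.symm hxw.symm with h1 | h1 | h1
    · exact absurd h1 hnuw
    · refine ⟨h1.symm, ?_⟩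
      by_contra h2
      exact h (hG.distinguishingColorable_of_adj_of_not_adj hconn G.degree_le_maxDegree hu hw hnuw
        huw hx h1.symm h2 hxw)
    · refine ⟨?_, h1.symm⟩
      by_contra h2
      exact h (hG.distinguishingColorable_of_adj_of_not_adj hconn G.degree_le_maxDegree hw hu
        (fun h => hnuw h.symm) huw.symm hx h1.symm h2 hxu)
  -- A complete graph has `Δ + 1` vertices, so an injective colouring suffices.
  have hnc : ∃ a b, a ≠ b ∧ ¬ G.Adj a b := by
    by_contra! htop
    obtain rfl : G = ⊤ := by
      ext a b
      exact ⟨fun h => h.ne, fun h => htop a b h⟩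
    obtain ⟨v⟩ := hconn.nonempty
    refine h (distinguishingColorable_card.mono ?_)
    have h1 : Fintype.card V - 1 = maxDegree (⊤ : SimpleGraph V) := by
      rw [← hreg v]
      convert (complete_graph_degree v).symm
    omega
  obtain ⟨r, u, w, hu, hw, huw, hnuw⟩ := hconn.exists_adj_adj_not_adj_of_not_top hnc
  have h2 : 2 ≤ G.maxDegree := by
    rw [← hreg r, ← card_neighborFinset_eq_degree, ← Finset.card_pair huw]
    refine Finset.card_le_card fun x hx => ?_
    rcases Finset.mem_insert.1 hx with rfl | hx
    · simpa using hu
    · rw [Finset.mem_singleton.1 hx]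
      simpa using hw
  rcases h2.eq_or_lt with h2 | h3
  · rw [← h2] at hreg h
    -- Order `4` is `d + 2` for `d = 2`, so the 4-cycle is covered by the multipartite case.
    exact (hreg.exists_iso_cycleGraph_of_not_distinguishingColorable hconn hG h).imp_right
      hreg.nonempty_iso_completeEquipartiteGraph
  · exact Or.inr (hreg.nonempty_iso_completeEquipartiteGraph
      (hreg.card_eq_of_forall_adj hconn hP h3 hu hw huw hnuw))

theorem not_distinguishingColorable_of_iso_cycleGraph_six (e : G ≃g cycleGraph 6) :
    ¬ G.DistinguishingColorable (G.maxDegree + 1) := by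
  have hreg : (cycleGraph 6).IsRegularOfDegree 2 := fun v => degree_cycleGraph (by norm_num) v
  rw [e.maxDegree_eq, hreg.maxDegree_eq]
  exact fun h => not_distinguishingColorable_cycleGraph_six (h.of_iso e)

theorem not_distinguishingColorable_of_iso_completeEquipartiteGraph [Nonempty V] {m : ℕ}
    (e : G ≃g completeEquipartiteGraph m 2) :
    ¬ G.DistinguishingColorable (G.maxDegree + 1) := by
  classical
  have hne : Nonempty (Fin m × Fin 2) := e.toEquiv.nonempty_congr.1 inferInstance
  -- Positivity of `m` is needed for `(m - 1) * 2 + 1 < m * 2` with truncated subtraction.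
  have hm := hne.some.1.pos
  have hreg : (completeEquipartiteGraph m 2).IsRegularOfDegree ((m - 1) * 2) :=
    fun v => degree_completeEquipartiteGraph v
  rw [e.maxDegree_eq, hreg.maxDegree_eq]
  exact fun h => not_distinguishingColorable_completeEquipartiteGraph (by omega) (h.of_iso e)

end SimpleGraph

theorem mainTheorem6 {V : Type*} [Fintype V] (G : SimpleGraph V) [DecidableRel G.Adj]
    (hconn : G.Connected) (hclaw : G.ClawFree) (n : ℕ) (hn : Fintype.card V = n) :
    G.distinguishingChromaticNumber ≤ (G.maxDegree : ℕ∞) + 2 ∧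
    (G.distinguishingChromaticNumber = (G.maxDegree : ℕ∞) + 2 ↔
      Nonempty (G ≃g SimpleGraph.cycleGraph 6) ∨
      (Even n ∧ Nonempty (G ≃g SimpleGraph.completeEquipartiteGraph (n / 2) 2))) := by
  subst hn
  have := hconn.nonempty
  have hle : G.distinguishingChromaticNumber ≤ (G.maxDegree : ℕ∞) + 2 := by
    obtain ⟨r⟩ := this
    -- With `K = Δ + 1`, every vertex has degree below `K` and can serve as the root.
    have h : G.DistinguishingColorable (G.maxDegree + 1 + 1) :=
      hclaw.distinguishingColorable_of_degree_lt hconn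
        (fun v => (G.degree_le_maxDegree v).trans (Nat.le_succ _))
        (Nat.lt_succ_of_le (G.degree_le_maxDegree r))
    exact_mod_cast SimpleGraph.distinguishingChromaticNumber_le_iff.2 h
  have hiff : G.distinguishingChromaticNumber = (G.maxDegree : ℕ∞) + 2 ↔
      ¬ G.DistinguishingColorable (G.maxDegree + 1) := by
    rw [← SimpleGraph.distinguishingChromaticNumber_le_iff, not_le]
    generalize G.distinguishingChromaticNumber = χ at hle
    have hsucc : ((G.maxDegree + 1 : ℕ) : ℕ∞) + 1 = (G.maxDegree : ℕ∞) + 2 := by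
      push_cast
      rw [add_assoc, one_add_one_eq_two]
    rw [← Order.add_one_le_iff_of_not_isMax (by simp), hsucc]
    exact ⟨fun h => h.ge, fun h => hle.antisymm h⟩
  refine ⟨hle, hiff.trans ⟨hclaw.exceptional_of_not_distinguishingColorable hconn, ?_⟩⟩
  rintro (⟨⟨e⟩⟩ | ⟨-, ⟨e⟩⟩)
  · exact SimpleGraph.not_distinguishingColorable_of_iso_cycleGraph_six e
  · exact SimpleGraph.not_distinguishingColorable_of_iso_completeEquipartiteGraph e
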